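/- Let $\Sigma$ be a finite alphabet. A probabilistic automaton $\mathcal A=(S,\Sigma,M,\pi,F)$ consists of a finite set $S$ of states, a probability vector $\pi\in\mathbb R^S$ (the initial distribution), non-negative matrices $M(a)\in\mathbb R^{S\times S}$ for $a\in\Sigma$, and a vector $F\in[0,1]^S$ such that one of the following holds: (acceptor) every $M(a)$ has unit row sums and $F$ is the indicator vector of a set of final states; or (generator of words) $F_s+\sum_{a\in\Sigma}\sum_{t\in S}M(a)_{st}=1$ for every $s\in S$. It assigns to each word $v=v_1\cdots v_\ell\in\Sigma^*$ the probability $p_{\mathcal A}(v)=\pi^{T}M(v_1)\cdots M(v_\ell)F$. Two probabilistic automata $\mathcal A_1,\mathcal A_2$ over $\Sigma$ are equivalent if $p_{\mathcal A_1}(v)=p_{\mathcal A_2}(v)$ for all $v\in\Sigma^*$. There is an algorithm that, given two probabilistic automata $\mathcal A_1=(S_1,\Sigma,M_1,\pi_1,F_1)$ and $\mathcal A_2=(S_2,\Sigma,M_2,\pi_2,F_2)$ with $N_1=|S_1|$ and $N_2=|S_2|$, decides whether they are equivalent in $O\big((|\Sigma|+1)N^4\big)$ operations, where $N=\max(N_1,N_2)$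 and the implied constant is absolute. Here an algorithm is a single program for a random access machine over $\mathbb R$ with exact arithmetic, and every arithmetic operation ($+,-,\times,/$), comparison, memory access and control step, on real numbers or on natural-number addresses and counters, counts as one operation. -/

import Mathlib

/-! ### Probabilistic automata -/

/-- The data `(S, Σ, M, π, F)` of a finite automaton with real weights, where `Σ = Fin k` and
`S = Fin N`: one transition matrix per symbol, an initial vector and a vector of final weights. -/
structure Automaton (k N : ℕ) where
  trans : Fin k → Matrix (Fin N) (Fin N) ℝ
  init : Fin N → ℝ
  final : Fin N → ℝ

namespace Automaton

variable {k N : ℕ}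

/-- The weights are those of a probabilistic acceptor: on reading `a` in state `s` the automaton
moves to `t` with probability `trans a s t`, and it accepts in the states of a set `F`. -/
def IsAcceptor (A : Automaton k N) : Prop :=
  ((∀ s, 0 ≤ A.init s) ∧ ∑ s, A.init s = 1) ∧
  (∀ a s, (∀ t, 0 ≤ A.trans a s t) ∧ ∑ t, A.trans a s t = 1) ∧
  ∃ F : Set (Fin N), A.final = F.indicator 1

/-- The weights are those of a probabilistic generator of finite words: in state `s` the automaton
stops with probability `final s`, or emits `a` and moves to `t` with probability `trans a s t`. -/
def IsGenerator (A : Automaton k N) : Prop :=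
  ((∀ s, 0 ≤ A.init s) ∧ ∑ s, A.init s = 1) ∧
  (∀ a s t, 0 ≤ A.trans a s t) ∧ (∀ s, 0 ≤ A.final s) ∧
  ∀ s, A.final s + ∑ a, ∑ t, A.trans a s t = 1

/-- Probabilistic automata, in either of the two usual senses. -/
def IsProbabilistic (A : Automaton k N) : Prop :=
  A.IsAcceptor ∨ A.IsGenerator

/-- The probability `π M(v₁) ⋯ M(vₜ) F` of the word `v`. -/
def wordProb (A : Automaton k N) (v : List (Fin k)) : ℝ :=
  A.init ⬝ᵥ ((v.map A.trans).prod).mulVec A.final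

/-- Two automata over the same alphabet are equivalent if every finite word has the same
probability under both. -/
def Equivalent {N₁ N₂ : ℕ} (A₁ : Automaton k N₁) (A₂ : Automaton k N₂) : Prop :=
  ∀ v : List (Fin k), A₁.wordProb v = A₂.wordProb v

end Automaton

/-! ### A real random access machine

Programs have finitely many registers holding natural numbers (used as counters and addresses) and
finitely many arrays of real numbers. Every arithmetic operation, comparison, memory access,
constant, assignment and branching has cost one. -/

namespace RealRAM

/-- `reg x` is the content of register `x`, and `arr m i` is the `i`-th cell of array `m`. -/
structure State where
  reg : ℕ → ℕ
  arr : ℕ → ℕ → ℝ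

/-- Expressions for natural numbers; `sub` is truncated subtraction. -/
inductive NatExpr where
  | lit (n : ℕ)
  | reg (x : ℕ)
  | add (e f : NatExpr)
  | sub (e f : NatExpr)
  | mul (e f : NatExpr)

/-- Expressions for real numbers; `cell m i` reads the cell of array `m` at address `i`. -/
inductive RealExpr where
  | lit (q : ℚ)
  | cell (m : ℕ) (i : NatExpr)
  | add (e f : RealExpr)
  | sub (e f : RealExpr)
  | mul (e f : RealExpr)
  | div (e f : RealExpr)

/-- Tests. -/
inductive Test where
  | natEq (e f : NatExpr)
  | natLt (e f : NatExpr)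
  | realEq (e f : RealExpr)
  | realLt (e f : RealExpr)
  | neg (b : Test)
  | conj (b c : Test)

/-- Programs. -/
inductive Program where
  | skip
  | setReg (x : ℕ) (e : NatExpr)
  | setCell (m : ℕ) (i : NatExpr) (e : RealExpr)
  | seq (P Q : Program)
  | branch (b : Test) (P Q : Program)
  | loop (b : Test) (P : Program)

namespace NatExpr

/-- The value of an expression. -/
def eval (σ : State) : NatExpr → ℕ
  | lit n => n
  | reg x => σ.reg x
  | add e f => e.eval σ + f.eval σ
  | sub e f => e.eval σ - f.eval σ
  | mul e f => e.eval σ * f.eval σ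

/-- The cost of evaluating an expression. -/
def cost : NatExpr → ℕ
  | lit _ => 1
  | reg _ => 1
  | add e f => e.cost + f.cost + 1
  | sub e f => e.cost + f.cost + 1
  | mul e f => e.cost + f.cost + 1

end NatExpr

namespace RealExpr

/-- The value of an expression. -/
noncomputable def eval (σ : State) : RealExpr → ℝ
  | lit q => (q : ℝ)
  | cell m i => σ.arr m (i.eval σ)
  | add e f => e.eval σ + f.eval σ
  | sub e f => e.eval σ - f.eval σ
  | mul e f => e.eval σ * f.eval σ
  | div e f => e.eval σ / f.eval σ

/-- No division by zero occurs in the evaluation. -/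
def Valid (σ : State) : RealExpr → Prop
  | lit _ => True
  | cell _ _ => True
  | add e f => e.Valid σ ∧ f.Valid σ
  | sub e f => e.Valid σ ∧ f.Valid σ
  | mul e f => e.Valid σ ∧ f.Valid σ
  | div e f => e.Valid σ ∧ f.Valid σ ∧ f.eval σ ≠ 0

/-- The cost of evaluating an expression. -/
def cost : RealExpr → ℕ
  | lit _ => 1
  | cell _ i => i.cost + 1
  | add e f => e.cost + f.cost + 1
  | sub e f => e.cost + f.cost + 1
  | mul e f => e.cost + f.cost + 1
  | div e f => e.cost + f.cost + 1

end RealExpr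

namespace Test

/-- The outcome of a test. -/
def Holds (σ : State) : Test → Prop
  | natEq e f => e.eval σ = f.eval σ
  | natLt e f => e.eval σ < f.eval σ
  | realEq e f => e.eval σ = f.eval σ
  | realLt e f => e.eval σ < f.eval σ
  | neg b => ¬ b.Holds σ
  | conj b c => b.Holds σ ∧ c.Holds σ

/-- No division by zero occurs in the evaluation. -/
def Valid (σ : State) : Test → Prop
  | natEq _ _ => True
  | natLt _ _ => True
  | realEq e f => e.Valid σ ∧ f.Valid σ
  | realLt e f => e.Valid σ ∧ f.Valid σ
  | neg b => b.Valid σ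
  | conj b c => b.Valid σ ∧ c.Valid σ

/-- The cost of evaluating a test. -/
def cost : Test → ℕ
  | natEq e f => e.cost + f.cost + 1
  | natLt e f => e.cost + f.cost + 1
  | realEq e f => e.cost + f.cost + 1
  | realLt e f => e.cost + f.cost + 1
  | neg b => b.cost + 1
  | conj b c => b.cost + c.cost + 1

end Test

/-- Overwrite register `x`. -/
def State.setReg (σ : State) (x n : ℕ) : State :=
  { σ with reg := Function.update σ.reg x n }

/-- Overwrite cell `i` of array `m`. -/
def State.setCell (σ : State) (m i : ℕ) (r : ℝ) : State :=
  { σ with arr := Function.update σ.arr m (Function.update (σ.arr m) i r) }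

/-- `Exec P σ τ t`: started in `σ`, the program `P` halts in the state `τ` after a computation of
total cost `t`. A division by zero has no continuation. -/
inductive Exec : Program → State → State → ℕ → Prop
  | skip (σ : State) : Exec .skip σ σ 1
  | setReg (σ : State) (x : ℕ) (e : NatExpr) :
      Exec (.setReg x e) σ (σ.setReg x (e.eval σ)) (e.cost + 1)
  | setCell (σ : State) (m : ℕ) (i : NatExpr) (e : RealExpr) (he : e.Valid σ) :
      Exec (.setCell m i e) σ (σ.setCell m (i.eval σ) (e.eval σ)) (i.cost + e.cost + 1)
  | seq {P Q : Program} {σ τ υ : State} {t u : ℕ} (hP : Exec P σ τ t) (hQ : Exec Q τ υ u) :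
      Exec (.seq P Q) σ υ (t + u)
  | branch_true {b : Test} {P Q : Program} {σ τ : State} {t : ℕ}
      (hv : b.Valid σ) (hb : b.Holds σ) (hP : Exec P σ τ t) :
      Exec (.branch b P Q) σ τ (b.cost + 1 + t)
  | branch_false {b : Test} {P Q : Program} {σ τ : State} {t : ℕ}
      (hv : b.Valid σ) (hb : ¬ b.Holds σ) (hQ : Exec Q σ τ t) :
      Exec (.branch b P Q) σ τ (b.cost + 1 + t)
  | loop_done {b : Test} {P : Program} {σ : State}
      (hv : b.Valid σ) (hb : ¬ b.Holds σ) :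
      Exec (.loop b P) σ σ (b.cost + 1)
  | loop_step {b : Test} {P : Program} {σ τ υ : State} {t u : ℕ}
      (hv : b.Valid σ) (hb : b.Holds σ) (hP : Exec P σ τ t) (hL : Exec (.loop b P) τ υ u) :
      Exec (.loop b P) σ υ (b.cost + 1 + t + u)

/-- Computations are deterministic, so result and cost are functions of program and input. -/
theorem Exec.deterministic {P : Program} {σ τ τ' : State} {t t' : ℕ}
    (h : Exec P σ τ t) (h' : Exec P σ τ' t') : τ = τ' ∧ t = t' := by
  induction h generalizing τ' t' with
  | skip => cases h'; exact ⟨rfl, rfl⟩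
  | setReg => cases h'; exact ⟨rfl, rfl⟩
  | setCell => cases h'; exact ⟨rfl, rfl⟩
  | seq _ _ ihP ihQ =>
    cases h' with
    | seq hP' hQ' =>
      obtain ⟨rfl, rfl⟩ := ihP hP'
      obtain ⟨rfl, rfl⟩ := ihQ hQ'
      exact ⟨rfl, rfl⟩
  | branch_true _ hb _ ih =>
    cases h' with
    | branch_true _ _ hP' => obtain ⟨rfl, rfl⟩ := ih hP'; exact ⟨rfl, rfl⟩
    | branch_false _ hb' _ => exact absurd hb hb'
  | branch_false _ hb _ ih =>
    cases h' with
    | branch_true _ hb' _ => exact absurd hb' hb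
    | branch_false _ _ hQ' => obtain ⟨rfl, rfl⟩ := ih hQ'; exact ⟨rfl, rfl⟩
  | loop_done _ hb =>
    cases h' with
    | loop_done => exact ⟨rfl, rfl⟩
    | loop_step _ hb' _ _ => exact absurd hb' hb
  | loop_step _ hb _ _ ihP ihL =>
    cases h' with
    | loop_done _ hb' => exact absurd hb hb'
    | loop_step _ _ hP' hL' =>
      obtain ⟨rfl, rfl⟩ := ihP hP'
      obtain ⟨rfl, rfl⟩ := ihL hL'
      exact ⟨rfl, rfl⟩

/-- A finite vector as the content of an array, filled up with zeros. -/
def vecArray {n : ℕ} (f : Fin n → ℝ) (i : ℕ) : ℝ :=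
  if h : i < n then f ⟨i, h⟩ else 0

/-- The transition matrices as the content of one array: the entry `trans a s t` is stored at
address `(a * N + s) * N + t`. -/
def transArray {k N : ℕ} (M : Fin k → Matrix (Fin N) (Fin N) ℝ) : ℕ → ℝ :=
  vecArray fun j : Fin (k * N * N) => M j.divNat.divNat j.divNat.modNat j.modNat

theorem transArray_apply {k N : ℕ} (M : Fin k → Matrix (Fin N) (Fin N) ℝ)
    (a : Fin k) (s t : Fin N) :
    transArray M ((a * N + s) * N + t) = M a s t := by
  have hN : 0 < N := s.pos
  have h1 : (a : ℕ) * N + s < k * N := by nlinarith [a.isLt, s.isLt]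
  have h2 : ((a : ℕ) * N + s) * N + t < k * N * N := by nlinarith [t.isLt]
  have e1 : (((a : ℕ) * N + s) * N + t) / N = a * N + s := by
    rw [Nat.add_comm, Nat.add_mul_div_right _ _ hN, Nat.div_eq_of_lt t.isLt, Nat.zero_add]
  have e2 : ((a : ℕ) * N + s) / N = a := by
    rw [Nat.add_comm, Nat.add_mul_div_right _ _ hN, Nat.div_eq_of_lt s.isLt, Nat.zero_add]
  have ha : (⟨_, h2⟩ : Fin (k * N * N)).divNat.divNat = a := by
    ext; simp [Fin.coe_divNat, e1, e2]
  have hs : (⟨_, h2⟩ : Fin (k * N * N)).divNat.modNat = s := by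
    ext; simp [Fin.coe_divNat, Fin.coe_modNat, e1, Nat.mod_eq_of_lt s.isLt]
  have ht : (⟨_, h2⟩ : Fin (k * N * N)).modNat = t := by
    ext; simp [Fin.coe_modNat, Nat.mod_eq_of_lt t.isLt]
  simp only [transArray, vecArray, dif_pos h2, ha, hs, ht]

/-- The initial state for the input `(A₁, A₂)`: registers 0, 1, 2 hold the size of the alphabet and
the two numbers of states, arrays 0 to 5 hold the weights, and everything else is zero. -/
def input {k N₁ N₂ : ℕ} (A₁ : Automaton k N₁) (A₂ : Automaton k N₂) : State where
  reg
    | 0 => k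
    | 1 => N₁
    | 2 => N₂
    | _ => 0
  arr
    | 0 => vecArray A₁.init
    | 1 => vecArray A₁.final
    | 2 => transArray A₁.trans
    | 3 => vecArray A₂.init
    | 4 => vecArray A₂.final
    | 5 => transArray A₂.trans
    | _ => fun _ => 0

/-- The answer of a halted computation: yes is 1 and no is 0 in register 0. -/
def Answers (τ : State) (p : Prop) : Prop :=
  (p ∧ τ.reg 0 = 1) ∨ (¬ p ∧ τ.reg 0 = 0)

end RealRAM

/-! ### Total correctness with a bound on the cost -/

namespace RealRAM

/-! Put d = N₁ + N₂. A word v leads the two initial vectors to a joint row vector in ℝ^d, and the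
difference of the two probabilities of v is the scalar product of this vector with f = (F₁, -F₂). So
the automata are equivalent iff f is orthogonal to the space W spanned by all joint vectors. W is
the smallest subspace that contains the joint initial vector and is stable under the block-diagonal
action of every letter.

A basis of W is found by saturation. For each vector b p found so far and each letter a, the image
of b p under a is reduced modulo the current span, and the residue is appended if it is non-zero.
The vectors are kept orthogonal, so the reduction is Gram–Schmidt and the test is whether a squared
norm vanishes; no square roots occur. Orthogonality bounds the number of vectors by d
(`IsOrthogonalBelow.le_dim`). Hence at most k * d images are treated, each at cost O(d²), and the
total O(k d³ + d²) is within the claimed bound.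

Correctness rests on `IsOrthogonalBelow.gramSchmidt_step`, `ClosedBefore.succ` and
`Automaton.equivalent_iff_of_isOrthogonalBelow`. The program is verified by rules for `Runs`, which
carry a postcondition and a cost bound together; each loop comes down to an invariant for
`Runs.forLoop`. -/

@[simp] theorem NatExpr.eval_setCell (e : NatExpr) (σ : State) (m i : ℕ) (r : ℝ) :
    e.eval (σ.setCell m i r) = e.eval σ := by
  induction e <;> simp_all [NatExpr.eval, State.setCell]

/-- Started in `σ`, the program `P` halts after a computation of cost at most `T` in a state
that satisfies `Q`. -/
def Runs (P : Program) (σ : State) (T : ℕ) (Q : State → Prop) : Prop :=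
  ∃ τ t, Exec P σ τ t ∧ t ≤ T ∧ Q τ

namespace Runs

variable {P P' : Program} {σ : State} {T T' : ℕ} {Q Q' : State → Prop}

theorem mono (h : Runs P σ T Q) (hT : T ≤ T') (hQ : ∀ τ, Q τ → Q' τ) : Runs P σ T' Q' := by
  obtain ⟨τ, t, h, ht, hq⟩ := h
  exact ⟨τ, t, h, ht.trans hT, hQ τ hq⟩

theorem skip (h : Q σ) : Runs .skip σ 1 Q := ⟨σ, 1, .skip σ, le_rfl, h⟩

theorem setReg {x : ℕ} {e : NatExpr} (h : Q (σ.setReg x (e.eval σ))) :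
    Runs (.setReg x e) σ (e.cost + 1) Q :=
  ⟨_, _, .setReg σ x e, le_rfl, h⟩

theorem setCell {m : ℕ} {i : NatExpr} {e : RealExpr} (he : e.Valid σ)
    (h : Q (σ.setCell m (i.eval σ) (e.eval σ))) :
    Runs (.setCell m i e) σ (i.cost + e.cost + 1) Q :=
  ⟨_, _, .setCell σ m i e he, le_rfl, h⟩

theorem seq (h : Runs P σ T Q') (h' : ∀ τ, Q' τ → Runs P' τ T' Q) :
    Runs (.seq P P') σ (T + T') Q := by
  obtain ⟨τ, t, h, ht, hq⟩ := h
  obtain ⟨υ, u, h', hu, hq'⟩ := h' τ hq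
  exact ⟨υ, t + u, .seq h h', add_le_add ht hu, hq'⟩

theorem branch {b : Test} (hv : b.Valid σ) (ht : b.Holds σ → Runs P σ T Q)
    (hf : ¬ b.Holds σ → Runs P' σ T Q) : Runs (.branch b P P') σ (b.cost + 1 + T) Q := by
  by_cases hb : b.Holds σ
  · obtain ⟨τ, t, h, ht, hq⟩ := ht hb
    exact ⟨τ, _, .branch_true hv hb h, by omega, hq⟩
  · obtain ⟨τ, t, h, ht, hq⟩ := hf hb
    exact ⟨τ, _, .branch_false hv hb h, by omega, hq⟩

end Runs

/-- Run `P` with the values `0, 1, …` of register `x`, as long as they are less than `e`. -/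
def forLoop (x : ℕ) (e : NatExpr) (P : Program) : Program :=
  .seq (.setReg x (.lit 0))
    (.loop (.natLt (.reg x) e) (.seq P (.setReg x (.add (.reg x) (.lit 1)))))

/-- Induction on the number of remaining rounds. The bound `e` is evaluated anew at every test, so
the invariant must force it to stay `n`. A round costs `e.cost + 3` for the test, `T` for the body
and 4 for the increment. -/
theorem Runs.forLoop {x : ℕ} {e : NatExpr} {P : Program} {σ : State} {n T : ℕ}
    {I : ℕ → State → Prop} (h0 : I 0 (σ.setReg x 0))
    (hI : ∀ i τ, I i τ → τ.reg x = i ∧ e.eval τ = n)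
    (hP : ∀ i τ, i < n → I i τ →
      Runs P τ T fun τ' => τ'.reg x = i ∧ I (i + 1) (τ'.setReg x (i + 1))) :
    Runs (forLoop x e P) σ (n * (T + e.cost + 7) + (e.cost + 5)) (I n) := by
  have key : ∀ j i τ, i + j = n → I i τ →
      Runs (.loop (.natLt (.reg x) e) (.seq P (.setReg x (.add (.reg x) (.lit 1))))) τ
        (j * (T + e.cost + 7) + (e.cost + 3)) (I n) := by
    intro j
    induction j with
    | zero =>
      intro i τ hi h
      obtain ⟨hx, he⟩ := hI i τ h
      obtain rfl : i = n := by omega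
      refine ⟨τ, _, .loop_done trivial ?_, ?_, h⟩
      · simp [Test.Holds, NatExpr.eval, hx, he]
      · simp [Test.cost, NatExpr.cost]; omega
    | succ j ih =>
      intro i τ hi h
      obtain ⟨hx, he⟩ := hI i τ h
      obtain ⟨τ', t, h1, ht, hx', h2⟩ := hP i τ (by omega) h
      obtain ⟨υ, u, h3, hu, hq⟩ := ih (i + 1) _ (by omega) h2
      have h4 : Exec (.setReg x (.add (.reg x) (.lit 1))) τ' (τ'.setReg x (i + 1)) 4 := by
        have := Exec.setReg τ' x (.add (.reg x) (.lit 1))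
        simpa [NatExpr.eval, NatExpr.cost, hx'] using this
      refine ⟨υ, _, .loop_step trivial ?_ (.seq h1 h4) h3, ?_, hq⟩
      · simp only [Test.Holds, NatExpr.eval, hx, he]; omega
      · simp only [Test.cost, NatExpr.cost]; rw [Nat.succ_mul]; omega
  refine ((Runs.setReg (Q := I 0) h0).seq fun τ h => key n 0 τ (by omega) h).mono ?_ fun _ h => h
  simp only [NatExpr.cost]; omega

/-- Store the sum of the values of `body` for `x < e` in the cell `c` of array `m`. -/
def sumInto (m : ℕ) (c : NatExpr) (x : ℕ) (e : NatExpr) (body : RealExpr) : Program :=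
  .seq (.setCell m c (.lit 0)) (forLoop x e (.setCell m c (.add (.cell m c) body)))

/-- Quantifying over `r` in `hb` says that the body does not read the accumulator cell. The final
state is then known exactly, with the partial sum as the invariant. -/
theorem Runs.sumInto {m : ℕ} {c : NatExpr} {x : ℕ} {e : NatExpr} {body : RealExpr} {σ : State}
    {n c₀ : ℕ} {g : ℕ → ℝ} (hc₀ : c.eval σ = c₀) (hc : ∀ i, c.eval (σ.setReg x i) = c₀)
    (he : ∀ i, e.eval (σ.setReg x i) = n)
    (hb : ∀ i < n, ∀ r, body.Valid ((σ.setReg x i).setCell m c₀ r) ∧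
      body.eval ((σ.setReg x i).setCell m c₀ r) = g i) :
    Runs (sumInto m c x e body) σ
      (n * (2 * c.cost + body.cost + e.cost + 10) + (c.cost + e.cost + 7))
      (fun τ => τ = (σ.setReg x n).setCell m c₀ (∑ i ∈ Finset.range n, g i)) := by
  have h1 : Runs (.setCell m c (.lit 0)) σ (c.cost + 1 + 1)
      (fun τ => τ = σ.setCell m c₀ 0) :=
    .setCell trivial (by simp [RealExpr.eval, hc₀])
  refine (h1.seq (T' := n * ((c.cost + (c.cost + 1 + body.cost + 1) + 1) + e.cost + 7)
    + (e.cost + 5)) fun τ hτ => ?_).mono ?_ fun _ h => h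
  · subst hτ
    refine Runs.forLoop (I := fun i τ => τ = (σ.setReg x i).setCell m c₀
      (∑ j ∈ Finset.range i, g j)) (by simp [State.setReg, State.setCell]) ?_ ?_
    · rintro i τ rfl
      exact ⟨by simp [State.setReg, State.setCell], by simp [he]⟩
    · rintro i τ hi rfl
      refine Runs.setCell ⟨trivial, (hb i hi _).1⟩ ⟨?_, ?_⟩
      · simp [State.setReg, State.setCell]
      · simp only [RealExpr.eval, NatExpr.eval_setCell, hc, (hb i hi _).2,
          Finset.sum_range_succ]
        simp [State.setReg, State.setCell]
  · apply le_of_eq; ring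

/-- Rule for loops over register 8 that fill `n` consecutive cells of array `m` with the values of
`g`, using register 9. -/
theorem Runs.fill {m : ℕ} {e : NatExpr} {P : Program} {σ : State} {n T base : ℕ} {g : ℕ → ℝ}
    (he : ∀ τ : State, (∀ y, y ≠ 8 → y ≠ 9 → τ.reg y = σ.reg y) → e.eval τ = n)
    (hP : ∀ (τ : State) (i : ℕ), i < n → τ.reg 8 = i →
      (∀ y, y ≠ 8 → y ≠ 9 → τ.reg y = σ.reg y) → (∀ l ≠ m, τ.arr l = σ.arr l) →
      (∀ j, (j < base ∨ base + i ≤ j) → τ.arr m j = σ.arr m j) →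
      Runs P τ T fun υ => (∀ y ≠ 9, υ.reg y = τ.reg y) ∧
        υ.arr = Function.update τ.arr m (Function.update (τ.arr m) (base + i) (g i))) :
    Runs (RealRAM.forLoop 8 e P) σ (n * (T + e.cost + 7) + (e.cost + 5)) fun τ =>
      (∀ y, y ≠ 8 → y ≠ 9 → τ.reg y = σ.reg y) ∧ (∀ l ≠ m, τ.arr l = σ.arr l) ∧
      (∀ i < n, τ.arr m (base + i) = g i) ∧
      (∀ j, (j < base ∨ base + n ≤ j) → τ.arr m j = σ.arr m j) := by
  refine (Runs.forLoop (n := n) (T := T) (I := fun i τ => τ.reg 8 = i ∧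
      (∀ y, y ≠ 8 → y ≠ 9 → τ.reg y = σ.reg y) ∧ (∀ l ≠ m, τ.arr l = σ.arr l) ∧
      (∀ j < i, τ.arr m (base + j) = g j) ∧
      (∀ j, (j < base ∨ base + i ≤ j) → τ.arr m j = σ.arr m j)) ?_ ?_ ?_).mono le_rfl
      fun τ h => h.2
  · simp +contextual [State.setReg]
  · intro i τ h
    exact ⟨h.1, he τ h.2.1⟩
  · rintro i τ hi ⟨h8, hr, ha, hd, hu⟩
    refine (hP τ i hi h8 hr ha hu).mono le_rfl ?_
    rintro υ ⟨hr', ha'⟩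
    refine ⟨by rw [hr' 8 (by decide), h8], by simp [State.setReg], ?_, ?_, ?_, ?_⟩
    · intro y h8 h9
      simp [State.setReg, h8, hr' y h9, hr y h8 h9]
    · intro l hl
      simp [State.setReg, ha', hl, ha l hl]
    · intro j hj
      rcases Nat.lt_succ_iff_lt_or_eq.1 hj with hj | rfl
      · simp [State.setReg, ha', hj.ne, hd j hj]
      · simp [State.setReg, ha']
    · intro j hj
      have : j ≠ base + i := by omega
      simp only [State.setReg, ha', Function.update_self, Function.update_of_ne this]
      exact hu j (by omega)

end RealRAM

/-! ### Orthogonal bases of the space reached by an automaton -/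

section OrthogonalBasis

variable {d : ℕ}

/-- The span of the first `n` vectors of a sequence. -/
def spanBelow (b : ℕ → Fin d → ℝ) (n : ℕ) : Submodule ℝ (Fin d → ℝ) :=
  Submodule.span ℝ (b '' Set.Iio n)

theorem mem_spanBelow {b : ℕ → Fin d → ℝ} {n i : ℕ} (h : i < n) : b i ∈ spanBelow b n :=
  Submodule.subset_span ⟨i, h, rfl⟩

theorem spanBelow_mono {b b' : ℕ → Fin d → ℝ} {n n' : ℕ} (hb : ∀ i < n, b' i = b i)
    (hn : n ≤ n') : spanBelow b n ≤ spanBelow b' n' := by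
  refine Submodule.span_le.2 ?_
  rintro _ ⟨i, hi, rfl⟩
  rw [← hb i hi]
  exact mem_spanBelow (lt_of_lt_of_le hi hn)

/-- The first `n` vectors of `b` are orthogonal and non-zero, they lie in `W`, and `w` is in their
span. -/
structure IsOrthogonalBelow (W : Submodule ℝ (Fin d → ℝ)) (w : Fin d → ℝ)
    (b : ℕ → Fin d → ℝ) (n : ℕ) : Prop where
  ne_zero : ∀ i < n, b i ≠ 0
  orth : ∀ i < n, ∀ j < n, i ≠ j → b i ⬝ᵥ b j = 0
  mem : ∀ i < n, b i ∈ W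
  init_mem : w ∈ spanBelow b n

namespace IsOrthogonalBelow

variable {W : Submodule ℝ (Fin d → ℝ)} {w : Fin d → ℝ} {b b' : ℕ → Fin d → ℝ} {n : ℕ}

/-- Non-zero orthogonal vectors are independent. The passage to `EuclideanSpace` supplies the inner
product. All bounds on loops over the found vectors come from here. -/
theorem le_dim (h : IsOrthogonalBelow W w b n) : n ≤ d := by
  have hli : LinearIndependent ℝ
      (fun i : Fin n => (WithLp.toLp 2 (b i) : EuclideanSpace ℝ (Fin d))) := by
    refine linearIndependent_of_ne_zero_of_inner_eq_zero (𝕜 := ℝ) ?_ ?_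
    · intro i hi
      apply h.ne_zero i i.2
      simpa using congrArg WithLp.ofLp hi
    · intro i j hij
      rw [EuclideanSpace.inner_toLp_toLp]
      simpa using h.orth j j.2 i i.2 (fun e => hij (Fin.ext e.symm))
  simpa using hli.fintype_card_le_finrank

theorem le_submodule (h : IsOrthogonalBelow W w b n) : spanBelow b n ≤ W := by
  refine Submodule.span_le.2 ?_
  rintro _ ⟨i, hi, rfl⟩
  exact h.mem i hi

/-- Lets the candidate, stored at index `n`, be rewritten freely. -/
theorem congr (h : IsOrthogonalBelow W w b n) (hb : ∀ i < n, b' i = b i) :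
    IsOrthogonalBelow W w b' n where
  ne_zero i hi := by rw [hb i hi]; exact h.ne_zero i hi
  orth i hi j hj hij := by rw [hb i hi, hb j hj]; exact h.orth i hi j hj hij
  mem i hi := by rw [hb i hi]; exact h.mem i hi
  init_mem := spanBelow_mono hb le_rfl h.init_mem

theorem succ (h : IsOrthogonalBelow W w b n) (hn : b n ≠ 0) (ho : ∀ i < n, b n ⬝ᵥ b i = 0)
    (hW : b n ∈ W) : IsOrthogonalBelow W w b (n + 1) where
  ne_zero i hi := by
    rcases Nat.lt_succ_iff_lt_or_eq.1 hi with hi | rfl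
    exacts [h.ne_zero i hi, hn]
  orth i hi j hj hij := by
    rcases Nat.lt_succ_iff_lt_or_eq.1 hi with hi | rfl <;>
      rcases Nat.lt_succ_iff_lt_or_eq.1 hj with hj | rfl
    · exact h.orth i hi j hj hij
    · rw [dotProduct_comm]; exact ho i hi
    · exact ho j hj
    · exact absurd rfl hij
  mem i hi := by
    rcases Nat.lt_succ_iff_lt_or_eq.1 hi with hi | rfl
    exacts [h.mem i hi, hW]
  init_mem := spanBelow_mono (fun _ _ => rfl) n.le_succ h.init_mem

theorem of_init (hw : w ≠ 0) (hW : w ∈ W) (hb : b 0 = w) : IsOrthogonalBelow W w b 1 where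
  ne_zero i hi := by obtain rfl : i = 0 := by omega
                     rwa [hb]
  orth i hi j hj hij := by omega
  mem i hi := by obtain rfl : i = 0 := by omega
                 rwa [hb]
  init_mem := by rw [← hb]; exact mem_spanBelow one_pos

/-- One step of the Gram–Schmidt process. -/
theorem gramSchmidt_step (h : IsOrthogonalBelow W w b n) {c v v' : Fin d → ℝ} {i : ℕ} (hi : i < n)
    (hv : c - v ∈ spanBelow b n) (ho : ∀ j < i, v ⬝ᵥ b j = 0)
    (hv' : v' = v - (v ⬝ᵥ b i / b i ⬝ᵥ b i) • b i) :
    c - v' ∈ spanBelow b n ∧ ∀ j < i + 1, v' ⬝ᵥ b j = 0 := by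
  subst hv'
  constructor
  · rw [sub_sub_eq_add_sub, add_sub_right_comm]
    exact add_mem hv (Submodule.smul_mem _ _ (mem_spanBelow hi))
  · intro j hj
    rw [sub_dotProduct, smul_dotProduct, smul_eq_mul]
    rcases Nat.lt_succ_iff_lt_or_eq.1 hj with hj | rfl
    · rw [ho j hj, h.orth i hi j (hj.trans hi) hj.ne', mul_zero, sub_zero]
    · rw [div_mul_cancel₀ _ (mt dotProduct_self_eq_zero.1 (h.ne_zero j hi)), sub_self]

end IsOrthogonalBelow

/-- The images under the maps `L x` of those vectors among the first `n` ones that were treated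
before the pair `(p, a)` are in the span of the first `n` vectors. -/
def ClosedBefore {k : ℕ} (L : Fin k → (Fin d → ℝ) →ₗ[ℝ] (Fin d → ℝ)) (b : ℕ → Fin d → ℝ)
    (n p a : ℕ) : Prop :=
  ∀ (i : ℕ) (x : Fin k), i < n → (i < p ∨ (i = p ∧ (x : ℕ) < a)) → L x (b i) ∈ spanBelow b n

/-- The step from `(p, a)` to `(p, a + 1)`: the image of `b p` is replaced by its residue modulo
the previous vectors, which is added to them unless it is zero. -/
theorem ClosedBefore.succ {k : ℕ} {L : Fin k → (Fin d → ℝ) →ₗ[ℝ] (Fin d → ℝ)}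
    {b b' : ℕ → Fin d → ℝ} {n n' p : ℕ} {a : Fin k} (h : ClosedBefore L b n p a) (hp : p < n)
    (hb : ∀ i < n, b' i = b i) (hr : L a (b p) - b' n ∈ spanBelow b n)
    (hn : (n' = n ∧ b' n = 0) ∨ (n' = n + 1)) : ClosedBefore L b' n' p (a + 1) := by
  have hnn : n ≤ n' := by omega
  have hle := spanBelow_mono hb hnn
  have hlast : b' n ∈ spanBelow b' n' := by
    rcases hn with ⟨-, h0⟩ | rfl
    · rw [h0]; exact zero_mem _
    · exact mem_spanBelow n.lt_succ_self
  intro i x hi hx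
  -- Treated indices satisfy `i ≤ p < n`, so an appended vector is not yet among them.
  have hin : i < n := by omega
  rw [hb i hin]
  -- Only the pair `(p, a)` is new: its image is an element of the old span plus the residue. All
  -- other images were in the old span already.
  by_cases hxa : i = p ∧ x = a
  · obtain ⟨rfl, rfl⟩ := hxa
    simpa using add_mem (hle hr) hlast
  · refine hle (h i x hin ?_)
    have : i = p → (x : ℕ) ≠ a := fun h1 h2 => hxa ⟨h1, Fin.ext h2⟩
    omega

end OrthogonalBasis

/-! ### The disjoint union of two automata and its reachable space. -/

namespace Automaton

variable {k N₁ N₂ : ℕ} (A₁ : Automaton k N₁) (A₂ : Automaton k N₂)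

/-- The action of a symbol on the row vectors of the disjoint union of two automata. -/
def jointStep (a : Fin k) : (Fin (N₁ + N₂) → ℝ) →ₗ[ℝ] (Fin (N₁ + N₂) → ℝ) where
  toFun v := Fin.append (Matrix.vecMul (fun s => v (Fin.castAdd N₂ s)) (A₁.trans a))
    (Matrix.vecMul (fun s => v (Fin.natAdd N₁ s)) (A₂.trans a))
  map_add' u v := by
    ext i
    refine Fin.addCases (fun i => ?_) (fun i => ?_) i <;>
      simp [Matrix.vecMul, dotProduct, add_mul, Finset.sum_add_distrib]
  map_smul' r v := by
    ext i
    refine Fin.addCases (fun i => ?_) (fun i => ?_) i <;>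
      simp [Matrix.vecMul, dotProduct, mul_assoc, Finset.mul_sum]

/-- The vector reached from the two initial vectors by reading a word. -/
def jointVec (v : List (Fin k)) : Fin (N₁ + N₂) → ℝ :=
  Fin.append (Matrix.vecMul A₁.init (v.map A₁.trans).prod)
    (Matrix.vecMul A₂.init (v.map A₂.trans).prod)

theorem jointVec_nil : jointVec A₁ A₂ [] = Fin.append A₁.init A₂.init := by
  simp [jointVec]

theorem jointStep_jointVec (a : Fin k) (v : List (Fin k)) :
    jointStep A₁ A₂ a (jointVec A₁ A₂ v) = jointVec A₁ A₂ (v ++ [a]) := by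
  simp [jointStep, jointVec, Matrix.vecMul_vecMul]

/-- The final weights of the difference of two automata. -/
def jointFinal : Fin (N₁ + N₂) → ℝ := Fin.append A₁.final (-A₂.final)

theorem jointVec_dotProduct_jointFinal (v : List (Fin k)) :
    jointVec A₁ A₂ v ⬝ᵥ jointFinal A₁ A₂ = A₁.wordProb v - A₂.wordProb v := by
  simp only [wordProb, Matrix.dotProduct_mulVec]
  simp [jointVec, jointFinal, dotProduct, Fin.sum_univ_add, sub_eq_add_neg]

/-- The space spanned by the vectors reached by words. -/
def reachable : Submodule ℝ (Fin (N₁ + N₂) → ℝ) :=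
  Submodule.span ℝ (Set.range (jointVec A₁ A₂))

theorem jointStep_mem_reachable (a : Fin k) {w : Fin (N₁ + N₂) → ℝ}
    (hw : w ∈ reachable A₁ A₂) : jointStep A₁ A₂ a w ∈ reachable A₁ A₂ := by
  have : reachable A₁ A₂ ≤ (reachable A₁ A₂).comap (jointStep A₁ A₂ a) := by
    refine Submodule.span_le.2 ?_
    rintro _ ⟨v, rfl⟩
    exact Submodule.subset_span ⟨v ++ [a], (jointStep_jointVec A₁ A₂ a v).symm⟩
  exact this hw

theorem init_ne_zero {N : ℕ} {A : Automaton k N} (hA : A.IsProbabilistic) : A.init ≠ 0 := by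
  intro h
  have : ∑ s, A.init s = 1 := by rcases hA with hA | hA <;> exact hA.1.2
  simp [h] at this

theorem pos_of_isProbabilistic {N : ℕ} {A : Automaton k N} (hA : A.IsProbabilistic) : 0 < N := by
  rcases Nat.eq_zero_or_pos N with rfl | h
  · exact absurd (Subsingleton.elim _ _) (init_ne_zero hA)
  · exact h

/-- Allows the joint initial vector to be the first basis vector without a test. -/
theorem jointVec_nil_ne_zero (hA : A₁.IsProbabilistic) : jointVec A₁ A₂ [] ≠ 0 := by
  rw [jointVec_nil]
  intro h
  apply init_ne_zero hA
  ext s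
  simpa using congrFun h (Fin.castAdd N₂ s)

/-- Two automata are equivalent if and only if the vector of final weights is orthogonal to a basis
of the reachable space. -/
theorem equivalent_iff_of_isOrthogonalBelow {b : ℕ → Fin (N₁ + N₂) → ℝ} {n p : ℕ}
    (h : IsOrthogonalBelow (reachable A₁ A₂) (jointVec A₁ A₂ []) b n)
    (hc : ClosedBefore (jointStep A₁ A₂) b n p 0) (hp : n ≤ p) :
    A₁.Equivalent A₂ ↔ ∀ i < n, b i ⬝ᵥ jointFinal A₁ A₂ = 0 := by
  constructor
  · intro heq i hi
    have hW : reachable A₁ A₂ ≤ LinearMap.ker ((dotProductBilin ℝ ℝ).flip (jointFinal A₁ A₂)) := by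
      refine Submodule.span_le.2 ?_
      rintro _ ⟨v, rfl⟩
      simp [jointVec_dotProduct_jointFinal, heq v]
    simpa using hW (h.mem i hi)
  · intro h0
    have hS : spanBelow b n ≤ LinearMap.ker ((dotProductBilin ℝ ℝ).flip (jointFinal A₁ A₂)) := by
      refine Submodule.span_le.2 ?_
      rintro _ ⟨i, hi, rfl⟩
      simpa using h0 i hi
    have hstep : ∀ a, spanBelow b n ≤ (spanBelow b n).comap (jointStep A₁ A₂ a) := by
      intro a
      refine Submodule.span_le.2 ?_
      rintro _ ⟨i, hi, rfl⟩
      exact hc i a hi (Or.inl (lt_of_lt_of_le hi hp))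
    -- The span contains the initial vector and is stable under all letters. Row vectors meet the
    -- last letter last, hence the induction from the right end of the word.
    have hv : ∀ v, jointVec A₁ A₂ v ∈ spanBelow b n := by
      intro v
      induction v using List.reverseRecOn with
      | nil => exact h.init_mem
      | append_singleton v a ih =>
        rw [← jointStep_jointVec]
        exact hstep a ih
    intro v
    have := hS (hv v)
    simp only [LinearMap.mem_ker, LinearMap.flip_apply, dotProductBilin_apply_apply,
      jointVec_dotProduct_jointFinal] at this
    exact sub_eq_zero.1 this

end Automaton

/-! ### The program

Registers 3 to 6 hold the dimension `d = N₁ + N₂`, the number `n` of vectors found so far, the index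
`p` of the vector that is being treated and the current symbol `a`; registers 7 to 9 are counters of
inner loops. Array 6 holds the vectors found so far, as rows of length `d`, followed by the current
candidate; array 7 holds the final weights, and array 8 is used for scalar products. -/

namespace RealRAM

/-- The rows of length `d` stored in an array. -/
def row (d : ℕ) (B : ℕ → ℝ) (i : ℕ) : Fin d → ℝ := fun s => B (i * d + s)

theorem row_dotProduct_row (d : ℕ) (B B' : ℕ → ℝ) (i j : ℕ) :
    row d B i ⬝ᵥ row d B' j = ∑ s ∈ Finset.range d, B (i * d + s) * B' (j * d + s) := by
  simp [dotProduct, row, Finset.sum_range]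

/-- The first `n` rows occupy exactly the cells below `n * d`, so work on row `n` leaves them
intact. -/
theorem row_congr {d n : ℕ} {B B' : ℕ → ℝ} (h : ∀ j < n * d, B' j = B j) (i : ℕ) (hi : i < n) :
    row d B' i = row d B i := by
  ext s
  refine h _ ?_
  calc i * d + s < i * d + d := by omega
    _ = (i + 1) * d := by ring
    _ ≤ n * d := Nat.mul_le_mul_right d hi

/-- The registers and arrays that are not used by the inner loops agree. -/
def AgreeOuter (σ τ : State) : Prop :=
  (∀ y < 7, τ.reg y = σ.reg y) ∧ ∀ l, l ≠ 6 → l ≠ 8 → τ.arr l = σ.arr l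

theorem AgreeOuter.trans {σ τ υ : State} (h : AgreeOuter σ τ) (h' : AgreeOuter τ υ) :
    AgreeOuter σ υ :=
  ⟨fun y hy => (h'.1 y hy).trans (h.1 y hy), fun l h6 h8 => (h'.2 l h6 h8).trans (h.2 l h6 h8)⟩

/-- The address of the entry with index in register `y` of the row with index in register `x`. -/
def rowAddr (x y : ℕ) : NatExpr := .add (.mul (.reg x) (.reg 3)) (.reg y)

@[simp] theorem eval_rowAddr (x y : ℕ) (σ : State) :
    (rowAddr x y).eval σ = σ.reg x * σ.reg 3 + σ.reg y := rfl

/-! ### Vector operations on rows: scalar product, matrix product, projection. -/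

/-- Store the scalar product of the row of array 6 with index in register `x` and the row of array
`m` at address `e` in cell `c` of array 8. -/
def rowDot (c x m : ℕ) (e : NatExpr) : Program :=
  sumInto 8 (.lit c) 9 (.reg 3) (.mul (.cell 6 (rowAddr x 9)) (.cell m e))

theorem Runs.rowDot {c x m : ℕ} {e : NatExpr} {σ : State} {base : ℕ} (hx : x ≠ 9) (hm : m ≠ 8)
    (he : ∀ i, e.eval (σ.setReg 9 i) = base + i) (hcost : e.cost ≤ 5) :
    Runs (rowDot c x m e) σ (σ.reg 3 * 27 + 9) fun τ =>
      τ = (σ.setReg 9 (σ.reg 3)).setCell 8 c (∑ s ∈ Finset.range (σ.reg 3),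
        σ.arr 6 (σ.reg x * σ.reg 3 + s) * σ.arr m (base + s)) := by
  refine (Runs.sumInto (n := σ.reg 3) (c₀ := c)
    (g := fun s => σ.arr 6 (σ.reg x * σ.reg 3 + s) * σ.arr m (base + s)) rfl (fun _ => rfl)
    (fun i => by simp [NatExpr.eval, State.setReg]) ?_).mono ?_ fun _ h => h
  · intro i hi r
    refine ⟨⟨trivial, trivial⟩, ?_⟩
    simp only [RealExpr.eval, NatExpr.eval_setCell, he]
    simp [State.setReg, State.setCell, hx, hm]
  · simp only [NatExpr.cost, RealExpr.cost, rowAddr]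
    refine Nat.add_le_add (Nat.mul_le_mul_left _ (by omega)) (by omega)

/-- Multiply a block of the row with index in register 5, which starts at `o` and has its length in
register `r`, by the matrix with index in register 6 in array `m`, and store the result in the row
with index in register 4. -/
def blockMul (m r : ℕ) (o : NatExpr) : Program :=
  forLoop 8 (.reg r) (sumInto 6 (.add (.add (.mul (.reg 4) (.reg 3)) o) (.reg 8)) 9 (.reg r)
    (.mul (.cell 6 (.add (.mul (.reg 5) (.reg 3)) (.add o (.reg 9))))
      (.cell m (.add (.mul (.add (.mul (.reg 6) (.reg r)) (.reg 9)) (.reg r)) (.reg 8)))))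

/-- Source and target are rows of the same array. The hypothesis `hp` puts the source strictly
before the target, so no cell is read after being overwritten. -/
theorem Runs.blockMul {m r : ℕ} {o : NatExpr} {σ : State} {O R d : ℕ} (hm : m ≠ 6) (hr8 : r ≠ 8)
    (hr9 : r ≠ 9) (hR : σ.reg r = R) (hd : σ.reg 3 = d)
    (ho : ∀ τ : State, (∀ y, y ≠ 8 → y ≠ 9 → τ.reg y = σ.reg y) → o.eval τ = O)
    (hcost : o.cost ≤ 1) (hp : σ.reg 5 < σ.reg 4) (hOR : O + R ≤ d) :
    Runs (blockMul m r o) σ (d * (d * 60 + 60) + 6) fun τ =>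
      (∀ y, y ≠ 8 → y ≠ 9 → τ.reg y = σ.reg y) ∧ (∀ l ≠ 6, τ.arr l = σ.arr l) ∧
      (∀ t < R, τ.arr 6 (σ.reg 4 * d + O + t) = ∑ s ∈ Finset.range R,
        σ.arr 6 (σ.reg 5 * d + (O + s)) * σ.arr m ((σ.reg 6 * R + s) * R + t)) ∧
      (∀ j, (j < σ.reg 4 * d + O ∨ σ.reg 4 * d + O + R ≤ j) → τ.arr 6 j = σ.arr 6 j) := by
  refine (Runs.fill (n := R) (T := d * 60 + 50) (base := σ.reg 4 * d + O) (fun τ h => ?_) ?_).mono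
    ?_ fun _ h => h
  · simp [NatExpr.eval, h r hr8 hr9, hR]
  · intro τ t ht h8 hreg harr hsame
    have hreg' : ∀ i y, y ≠ 8 → y ≠ 9 → (τ.setReg 9 i).reg y = σ.reg y := by
      intro i y h8 h9
      simp [State.setReg, h9, hreg y h8 h9]
    have h8' : ∀ i, (τ.setReg 9 i).reg 8 = t := by
      intro i; simp [State.setReg, h8]
    have h9' : ∀ i, (τ.setReg 9 i).reg 9 = i := by
      intro i; simp [State.setReg]
    refine (Runs.sumInto (n := R) (c₀ := σ.reg 4 * d + O + t) (g := fun s =>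
      σ.arr 6 (σ.reg 5 * d + (O + s)) * σ.arr m ((σ.reg 6 * R + s) * R + t)) ?_ ?_ ?_ ?_).mono ?_ ?_
    · simp [NatExpr.eval, hreg 4, hreg 3, ho τ hreg, h8, hd]
    · intro i
      simp [NatExpr.eval, hreg' i 4, hreg' i 3, ho _ (hreg' i), h8', hd]
    · intro i
      simp [NatExpr.eval, hreg' i r hr8 hr9, hR]
    · intro s hs u
      refine ⟨⟨trivial, trivial⟩, ?_⟩
      have hlt : σ.reg 5 * d + (O + s) < σ.reg 4 * d + O := by
        have : (σ.reg 5 + 1) * d ≤ σ.reg 4 * d := Nat.mul_le_mul_right d hp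
        rw [Nat.add_mul, Nat.one_mul] at this
        omega
      have hne : σ.reg 5 * d + (O + s) ≠ σ.reg 4 * d + O + t := by omega
      simp only [RealExpr.eval, NatExpr.eval_setCell]
      simp only [NatExpr.eval, hreg' s 5 (by decide) (by decide), hreg' s 3 (by decide) (by decide),
        hreg' s 6 (by decide) (by decide), hreg' s r hr8 hr9, h8', h9', ho _ (hreg' s), hd, hR]
      simp only [State.setCell, State.setReg, Function.update_self, Function.update_of_ne hm,
        Function.update_of_ne hne]
      rw [hsame _ (Or.inl hlt), harr m hm]
    · simp only [NatExpr.cost, RealExpr.cost]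
      refine Nat.add_le_add (Nat.mul_le_mul (by omega) (by omega)) (by omega)
    · rintro υ rfl
      refine ⟨fun y hy => ?_, rfl⟩
      simp [State.setReg, State.setCell, hy]
  · simp only [NatExpr.cost]
    refine Nat.add_le_add (Nat.mul_le_mul (by omega) (by omega)) (by omega)

/-- Subtract from the row with index in register 4 its projection to the row with index in
register 7. -/
def projectStep : Program :=
  .seq (rowDot 0 4 6 (rowAddr 7 9)) <| .seq (rowDot 1 7 6 (rowAddr 7 9)) <|
    forLoop 8 (.reg 3) (.setCell 6 (rowAddr 4 8) (.sub (.cell 6 (rowAddr 4 8))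
      (.mul (.div (.cell 8 (.lit 0)) (.cell 8 (.lit 1))) (.cell 6 (rowAddr 7 8)))))

/-- Both scalar products are stored in array 8 before the candidate changes, so the coefficient
stays fixed during the subtraction. The divisor is a squared norm, non-zero by `h0`. -/
theorem Runs.projectStep {σ : State} {d n : ℕ} (hd : σ.reg 3 = d) (hn : σ.reg 4 = n)
    (hi : σ.reg 7 < n) (h0 : row d (σ.arr 6) (σ.reg 7) ≠ 0) :
    Runs projectStep σ (d * 100 + 30) fun τ => AgreeOuter σ τ ∧ τ.reg 7 = σ.reg 7 ∧
      (∀ j < n * d, τ.arr 6 j = σ.arr 6 j) ∧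
      row d (τ.arr 6) n = row d (σ.arr 6) n -
        (row d (σ.arr 6) n ⬝ᵥ row d (σ.arr 6) (σ.reg 7) /
          row d (σ.arr 6) (σ.reg 7) ⬝ᵥ row d (σ.arr 6) (σ.reg 7)) • row d (σ.arr 6) (σ.reg 7) := by
  subst hd hn
  set i := σ.reg 7 with hi'
  have hlt : ∀ t < σ.reg 3, i * σ.reg 3 + t < σ.reg 4 * σ.reg 3 := by
    intro t ht
    have : (i + 1) * σ.reg 3 ≤ σ.reg 4 * σ.reg 3 := Nat.mul_le_mul_right _ hi
    rw [Nat.add_mul, Nat.one_mul] at this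
    omega
  refine ((Runs.rowDot (base := i * σ.reg 3) (by decide) (by decide)
    (fun j => by simp [State.setReg, hi']) (by decide)).seq
    (T' := σ.reg 3 * 27 + 9 + (σ.reg 3 * 46 + 6)) fun τ hτ => ?_).mono (by omega) fun _ h => h
  rw [← row_dotProduct_row] at hτ
  refine ((Runs.rowDot (base := i * σ.reg 3) (by decide) (by decide)
    (fun j => by simp [State.setReg, State.setCell, hτ, hi']) (by decide)).seq
    (T' := σ.reg 3 * 46 + 6) fun υ hυ => ?_).mono ?_ fun _ h => h
  · have e3 : τ.reg 3 = σ.reg 3 := by simp [hτ, State.setReg, State.setCell]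
    have e7 : τ.reg 7 = i := by simp [hτ, State.setReg, State.setCell, hi']
    have e6 : τ.arr 6 = σ.arr 6 := by simp [hτ, State.setReg, State.setCell]
    rw [e3, e7, e6, ← row_dotProduct_row] at hυ
    have r : ∀ y, y ≠ 9 → υ.reg y = σ.reg y := by
      intro y hy; simp [hυ, hτ, State.setReg, State.setCell, hy]
    have a : ∀ l, l ≠ 8 → υ.arr l = σ.arr l := by
      intro l hl; simp [hυ, hτ, State.setReg, State.setCell, hl]
    have a0 : υ.arr 8 0 = row (σ.reg 3) (σ.arr 6) (σ.reg 4) ⬝ᵥ row (σ.reg 3) (σ.arr 6) i := by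
      simp [hυ, hτ, State.setReg, State.setCell]
    have a1 : υ.arr 8 1 = row (σ.reg 3) (σ.arr 6) i ⬝ᵥ row (σ.reg 3) (σ.arr 6) i := by
      simp [hυ, State.setReg, State.setCell]
    clear_value i
    refine (Runs.fill (m := 6) (n := σ.reg 3) (base := σ.reg 4 * σ.reg 3)
      (g := fun t => υ.arr 6 (σ.reg 4 * σ.reg 3 + t) -
        υ.arr 8 0 / υ.arr 8 1 * υ.arr 6 (i * σ.reg 3 + t)) (T := 38) (fun ρ h => ?_) ?_).mono ?_ ?_
    · simp [NatExpr.eval, h 3, r 3]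
    · intro ρ t ht h8 hreg harr hsame
      have f3 : ρ.reg 3 = σ.reg 3 := by rw [hreg 3 (by decide) (by decide), r 3 (by decide)]
      have f4 : ρ.reg 4 = σ.reg 4 := by rw [hreg 4 (by decide) (by decide), r 4 (by decide)]
      have f7 : ρ.reg 7 = i := by rw [hreg 7 (by decide) (by decide), r 7 (by decide), hi']
      refine (Runs.setCell ?_ ?_).mono (T := (rowAddr 4 8).cost + _ + 1) (by decide) fun _ h => h
      · refine ⟨trivial, ⟨trivial, trivial, ?_⟩, trivial⟩
        simp only [RealExpr.eval, NatExpr.eval]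
        rw [harr 8 (by decide), a1]
        exact mt dotProduct_self_eq_zero.1 h0
      · refine ⟨fun y _ => rfl, ?_⟩
        simp only [RealExpr.eval, NatExpr.eval, eval_rowAddr, State.setCell, f3, f4, f7, h8]
        -- Entry `t` of the candidate is still the old one, and row `i` lies entirely below the
        -- candidate.
        rw [harr 8 (by decide), hsame _ (Or.inr le_rfl), hsame _ (Or.inl (hlt t ht))]
    · simp only [NatExpr.cost]; omega
    · rintro ρ ⟨hreg, harr, hnew, hold⟩
      refine ⟨⟨fun y hy => ?_, fun l h6 h8 => ?_⟩, ?_, fun j hj => ?_, ?_⟩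
      · rw [hreg y (by omega) (by omega), r y (by omega)]
      · rw [harr l h6, a l h8]
      · rw [hreg 7 (by decide) (by decide), r 7 (by decide), hi']
      · rw [hold j (Or.inl hj), a 6 (by decide)]
      · ext t
        simp only [row, Pi.sub_apply, Pi.smul_apply, smul_eq_mul]
        rw [hnew t t.2, a0, a1, a 6 (by decide)]
  · have e3 : τ.reg 3 = σ.reg 3 := by simp [hτ, State.setReg, State.setCell]
    omega

/-- Make the row with index in register 4 orthogonal to all previous ones. -/
def orthogonalize : Program := forLoop 7 (.reg 4) projectStep

/-- Modified Gram–Schmidt: each coefficient is computed from the current residue. The invariant is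
that the residue differs from the candidate by an element of the span and is orthogonal to the rows
already handled. -/
theorem Runs.orthogonalize {σ : State} {d n : ℕ} {W : Submodule ℝ (Fin d → ℝ)} {w : Fin d → ℝ}
    (hd : σ.reg 3 = d) (hn : σ.reg 4 = n) (h : IsOrthogonalBelow W w (row d (σ.arr 6)) n) :
    Runs orthogonalize σ (d * (d * 100 + 40) + 6) fun τ => AgreeOuter σ τ ∧
      (∀ j < n * d, τ.arr 6 j = σ.arr 6 j) ∧
      row d (σ.arr 6) n - row d (τ.arr 6) n ∈ spanBelow (row d (σ.arr 6)) n ∧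
      ∀ i < n, row d (τ.arr 6) n ⬝ᵥ row d (σ.arr 6) i = 0 := by
  refine (Runs.forLoop (n := n) (T := d * 100 + 30) (I := fun i τ => τ.reg 7 = i ∧
    AgreeOuter σ τ ∧ (∀ j < n * d, τ.arr 6 j = σ.arr 6 j) ∧
      row d (σ.arr 6) n - row d (τ.arr 6) n ∈ spanBelow (row d (σ.arr 6)) n ∧
      ∀ j < i, row d (τ.arr 6) n ⬝ᵥ row d (σ.arr 6) j = 0) ?_ ?_ ?_).mono ?_ fun τ h => h.2
  · refine ⟨by simp [State.setReg], ⟨fun y hy => ?_, fun _ _ _ => rfl⟩, fun _ _ => rfl, ?_, ?_⟩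
    · simp [State.setReg, hy.ne]
    · simp [State.setReg]
    · intro j hj; omega
  · rintro i τ ⟨h7, hout, -⟩
    exact ⟨h7, by simp [NatExpr.eval, hout.1 4, hn]⟩
  · rintro i τ hi ⟨h7, hout, hold, hspan, horth⟩
    have hrow := row_congr hold
    refine (Runs.projectStep (d := d) (n := n) (by rw [hout.1 3 (by decide), hd])
      (by rw [hout.1 4 (by decide), hn]) (by omega)
      (by rw [h7, hrow i hi]; exact h.ne_zero i hi)).mono le_rfl ?_
    rintro υ ⟨hout', h7', hold', hnew⟩
    rw [h7, hrow i hi] at hnew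
    have := h.gramSchmidt_step hi hspan horth hnew
    refine ⟨h7'.trans h7, by simp [State.setReg], ⟨fun y hy => ?_, ?_⟩, fun j hj => ?_, this⟩
    · rw [← (hout.trans hout').1 y hy]
      simp [State.setReg, hy.ne]
    · exact (hout.trans hout').2
    · exact (hold' j hj).trans (hold j hj)
  · simp only [NatExpr.cost]
    have := h.le_dim
    refine Nat.add_le_add (Nat.mul_le_mul this (by omega)) (by omega)

/-! ### Invariants of the saturation. -/

section Verification

variable {k N₁ N₂ : ℕ} {A₁ : Automaton k N₁} {A₂ : Automaton k N₂}

/-- The sizes, the transition matrices and the final weights are in their places. -/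
structure Loaded (A₁ : Automaton k N₁) (A₂ : Automaton k N₂) (σ : State) : Prop where
  reg0 : σ.reg 0 = k
  reg1 : σ.reg 1 = N₁
  reg2 : σ.reg 2 = N₂
  reg3 : σ.reg 3 = N₁ + N₂
  arr2 : σ.arr 2 = transArray A₁.trans
  arr5 : σ.arr 5 = transArray A₂.trans
  arr7 : ∀ s : Fin (N₁ + N₂), σ.arr 7 s = Automaton.jointFinal A₁ A₂ s

theorem Loaded.congr {σ τ : State} (h : Loaded A₁ A₂ σ) (hr : ∀ y < 4, τ.reg y = σ.reg y)
    (ha : ∀ l, l ≠ 6 → l ≠ 8 → τ.arr l = σ.arr l) : Loaded A₁ A₂ τ where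
  reg0 := by rw [hr 0 (by decide), h.reg0]
  reg1 := by rw [hr 1 (by decide), h.reg1]
  reg2 := by rw [hr 2 (by decide), h.reg2]
  reg3 := by rw [hr 3 (by decide), h.reg3]
  arr2 := by rw [ha 2 (by decide) (by decide), h.arr2]
  arr5 := by rw [ha 5 (by decide) (by decide), h.arr5]
  arr7 s := by rw [ha 7 (by decide) (by decide), h.arr7]

/-- Compute the image of the row with index in register 5 under the symbol in register 6 as the row
with index in register 4. -/
def image : Program := .seq (blockMul 2 1 (.lit 0)) (blockMul 5 2 (.reg 1))

theorem Runs.image {σ : State} (h : Loaded A₁ A₂ σ) (hp : σ.reg 5 < σ.reg 4) {a : Fin k}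
    (ha : σ.reg 6 = a) :
    Runs image σ (2 * ((N₁ + N₂) * ((N₁ + N₂) * 60 + 60) + 6)) fun τ => AgreeOuter σ τ ∧
      (∀ j < σ.reg 4 * (N₁ + N₂), τ.arr 6 j = σ.arr 6 j) ∧
      row (N₁ + N₂) (τ.arr 6) (σ.reg 4) =
        Automaton.jointStep A₁ A₂ a (row (N₁ + N₂) (σ.arr 6) (σ.reg 5)) := by
  refine ((Runs.blockMul (R := N₁) (O := 0) (by decide) (by decide) (by decide) h.reg1 h.reg3
    (fun _ _ => rfl) le_rfl hp (by omega)).seq fun τ hτ => ?_).mono (two_mul _).ge fun _ h => h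
  obtain ⟨hr, har, hnew, hold⟩ := hτ
  refine (Runs.blockMul (R := N₂) (O := N₁) (d := N₁ + N₂) (by decide) (by decide) (by decide)
    (by rw [hr 2 (by decide) (by decide), h.reg2]) (by rw [hr 3 (by decide) (by decide), h.reg3])
    (fun υ hυ => by rw [← h.reg1, ← hr 1 (by decide) (by decide),
      ← hυ 1 (by decide) (by decide)]; rfl)
    le_rfl (by rwa [hr 5 (by decide) (by decide), hr 4 (by decide) (by decide)]) le_rfl).mono
    le_rfl ?_
  rintro υ ⟨hr', har', hnew', hold'⟩
  rw [hr 4 (by decide) (by decide)] at hnew' hold'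
  rw [hr 5 (by decide) (by decide), hr 6 (by decide) (by decide), har 5 (by decide)] at hnew'
  refine ⟨⟨fun y hy => ?_, fun l h6 _ => ?_⟩, fun j hj => ?_, ?_⟩
  · rw [hr' y (by omega) (by omega), hr y (by omega) (by omega)]
  · rw [har' l h6, har l h6]
  · rw [hold' j (by omega), hold j (by omega)]
  · ext t
    refine Fin.addCases (fun t => ?_) (fun t => ?_) t
    · simp only [row, Fin.val_castAdd]
      rw [hold' _ (by omega), ← Nat.add_zero (σ.reg 4 * _), hnew t t.2, h.arr2, ha,
        Finset.sum_range]
      simp [Automaton.jointStep, Matrix.vecMul, dotProduct, row, transArray_apply]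
    · simp only [row, Fin.val_natAdd]
      rw [← Nat.add_assoc, hnew' t t.2, h.arr5, ha, Finset.sum_range]
      simp only [transArray_apply, Automaton.jointStep, LinearMap.coe_mk, AddHom.coe_mk,
        Fin.append_right, Matrix.vecMul, dotProduct, row, Fin.val_natAdd]
      refine Finset.sum_congr rfl fun s _ => ?_
      have hlt : σ.reg 5 * (N₁ + N₂) + (N₁ + s) < σ.reg 4 * (N₁ + N₂) := by
        have := Nat.mul_le_mul_right (N₁ + N₂) (Nat.succ_le_of_lt hp)
        rw [Nat.succ_mul] at this
        omega
      -- The first block product changed only the target row, so the second one still reads the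
      -- original source row.
      rw [hold _ (by omega)]

/-- Treat the symbol in register 6 and the row with index in register 5. -/
def extendBasis : Program :=
  .seq image <| .seq orthogonalize <| .seq (rowDot 0 4 6 (rowAddr 4 9)) <|
    .branch (.realEq (.cell 8 (.lit 0)) (.lit 0)) .skip (.setReg 4 (.add (.reg 4) (.lit 1)))

/-- The rows found so far are an orthogonal basis of a part of the reachable space, and all pairs
before `(p, a)` have been treated. -/
structure Explored (A₁ : Automaton k N₁) (A₂ : Automaton k N₂) (σ : State) (p a : ℕ) : Prop where
  loaded : Loaded A₁ A₂ σ
  basis : IsOrthogonalBelow (Automaton.reachable A₁ A₂) (Automaton.jointVec A₁ A₂ [])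
    (row (N₁ + N₂) (σ.arr 6)) (σ.reg 4)
  closed : ClosedBefore (Automaton.jointStep A₁ A₂) (row (N₁ + N₂) (σ.arr 6)) (σ.reg 4) p a

/-- Registers above 4 are counters, which the invariant does not mention. -/
theorem Explored.setReg {σ : State} {p a x v : ℕ} (h : Explored A₁ A₂ σ p a) (hx : 4 < x) :
    Explored A₁ A₂ (σ.setReg x v) p a := by
  have hr : ∀ y ≤ 4, (σ.setReg x v).reg y = σ.reg y := by
    intro y hy; simp [State.setReg, (hy.trans_lt hx).ne]
  refine ⟨h.loaded.congr (fun y hy => hr y hy.le) fun _ _ _ => rfl, ?_, ?_⟩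
  · rw [hr 4 le_rfl]; exact h.basis
  · rw [hr 4 le_rfl]; exact h.closed

theorem Explored.next {σ : State} {p : ℕ} (h : Explored A₁ A₂ σ p k) :
    Explored A₁ A₂ σ (p + 1) 0 :=
  ⟨h.loaded, h.basis, fun i x hi hx => h.closed i x hi (by have := x.2; omega)⟩

/-- The residue already sits in row `n`, just behind the basis. Accepting it means incrementing
register 4; a zero residue is left there for the next candidate to overwrite. -/
theorem Runs.extendBasis {σ : State} {p : ℕ} {a : Fin k} (h : Explored A₁ A₂ σ p a)
    (h5 : σ.reg 5 = p) (hp : p < σ.reg 4) (ha : σ.reg 6 = a) :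
    Runs extendBasis σ ((N₁ + N₂) * ((N₁ + N₂) * 220 + 187) + 36) fun τ =>
      τ.reg 5 = p ∧ p < τ.reg 4 ∧ τ.reg 6 = a ∧ Explored A₁ A₂ τ p (a + 1) := by
  subst h5
  set d := N₁ + N₂ with hd
  set n := σ.reg 4 with hn
  refine ((Runs.image h.loaded hp ha).seq (T' := d * (d * 100 + 40) + 6 + (d * 27 + 9 + 9))
    fun τ₁ h₁ => ?_).mono (by rw [← hd]; ring_nf; omega) fun _ h => h
  obtain ⟨out₁, old₁, new₁⟩ := h₁
  have row₁ := row_congr old₁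
  have basis₁ := h.basis.congr row₁
  have r3 : τ₁.reg 3 = d := by rw [out₁.1 3 (by decide), h.loaded.reg3]
  have r4 : τ₁.reg 4 = n := out₁.1 4 (by decide)
  refine (Runs.orthogonalize r3 r4 basis₁).seq fun τ₂ h₂ => ?_
  obtain ⟨out₂, old₂, span₂, orth₂⟩ := h₂
  have row₂ := row_congr old₂
  have s3 : τ₂.reg 3 = d := by rw [out₂.1 3 (by decide), r3]
  have s4 : τ₂.reg 4 = n := by rw [out₂.1 4 (by decide), r4]
  have h₃ := Runs.rowDot (c := 0) (x := 4) (m := 6) (e := rowAddr 4 9) (σ := τ₂) (base := n * d)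
    (by decide) (by decide) (fun i => by simp [State.setReg, s3, s4]) (by decide)
  rw [s3, s4, ← row_dotProduct_row] at h₃
  refine h₃.seq fun τ₃ h₃ => ?_
  have hle : spanBelow (row d (τ₁.arr 6)) n ≤ spanBelow (row d (σ.arr 6)) n :=
    spanBelow_mono (fun i hi => (row₁ i hi).symm) le_rfl
  have row₂' : ∀ i < n, row d (τ₂.arr 6) i = row d (σ.arr 6) i := fun i hi =>
    (row₂ i hi).trans (row₁ i hi)
  have basis₂ := basis₁.congr row₂
  have a6 : τ₃.arr 6 = τ₂.arr 6 := by simp [h₃, State.setReg, State.setCell]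
  have a8 : τ₃.arr 8 0 = row d (τ₂.arr 6) n ⬝ᵥ row d (τ₂.arr 6) n := by
    simp [h₃, State.setReg, State.setCell]
  have out₃ : AgreeOuter τ₂ τ₃ := by
    refine ⟨fun y hy => ?_, fun l _ h8 => ?_⟩
    · simp [h₃, State.setReg, State.setCell, (show y ≠ 9 by omega)]
    · simp [h₃, State.setReg, State.setCell, h8]
  have out := (out₁.trans out₂).trans out₃
  rw [new₁] at span₂
  -- The residue is the image minus an element of the span, and both lie in the reachable space.
  have hrW : row d (τ₂.arr 6) n ∈ Automaton.reachable A₁ A₂ := by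
    have := sub_mem (Automaton.jointStep_mem_reachable A₁ A₂ a (h.basis.mem _ hp))
      (basis₁.le_submodule span₂)
    simpa using this
  refine (Runs.branch (T := 4) (by exact ⟨trivial, trivial⟩)
    (fun hb => ?_) (fun hb => ?_)).mono (by decide)
    fun _ h => h
  · have hz : row d (τ₂.arr 6) n = 0 := by
      simpa [Test.Holds, RealExpr.eval, NatExpr.eval, a8, dotProduct_self_eq_zero] using hb
    have e4 : τ₃.reg 4 = n := out.1 4 (by decide)
    refine (Runs.skip ?_).mono (by decide) fun _ h => h
    refine ⟨out.1 5 (by decide), by rwa [e4], by rw [out.1 6 (by decide), ha],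
      h.loaded.congr (fun y hy => out.1 y (by omega)) out.2, ?_, ?_⟩
    · rw [a6, e4]; exact basis₂
    · rw [a6, e4]
      exact h.closed.succ hp row₂' (hle span₂) (Or.inl ⟨rfl, hz⟩)
  · have hz : row d (τ₂.arr 6) n ≠ 0 := by
      simpa [Test.Holds, RealExpr.eval, NatExpr.eval, a8, dotProduct_self_eq_zero] using hb
    refine Runs.setReg ?_
    have e : ∀ y < 7, y ≠ 4 → (τ₃.setReg 4 (τ₃.reg 4 + 1)).reg y = σ.reg y := by
      intro y hy h4
      rw [← out.1 y hy]; simp [State.setReg, h4]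
    have e4 : (τ₃.setReg 4 (τ₃.reg 4 + 1)).reg 4 = n + 1 := by
      simp [State.setReg, out.1 4, ← hn]
    have e6 : (τ₃.setReg 4 (τ₃.reg 4 + 1)).arr 6 = τ₂.arr 6 := a6
    simp only [NatExpr.eval]
    refine ⟨e 5 (by decide) (by decide), by rw [e4]; omega,
      by rw [e 6 (by decide) (by decide), ha],
      h.loaded.congr (fun y hy => e y (by omega) (by omega)) out.2, ?_, ?_⟩
    · rw [e4, e6]
      refine basis₂.succ hz (fun i hi => ?_) hrW
      rw [row₂ i hi]; exact orth₂ i hi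
    · rw [e4, e6]
      exact h.closed.succ hp row₂' (hle span₂) (Or.inr rfl)

/-- Treat all pairs of a row and a symbol. -/
def explore : Program :=
  forLoop 5 (.reg 3) (.branch (.natLt (.reg 5) (.reg 4)) (forLoop 6 (.reg 0) extendBasis) .skip)

/-- The number of rows grows while the loop runs, so register 4 could not serve as the fixed bound
that `Runs.forLoop` needs. The loop runs to `d` instead, which is at least the number of rows, and a
guard skips indices with no row. -/
theorem Runs.explore {σ : State} (h : Explored A₁ A₂ σ 0 0) :
    Runs explore σ ((N₁ + N₂) * (k * ((N₁ + N₂) * ((N₁ + N₂) * 220 + 187) + 44) + 18) + 6)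
      fun τ => Explored A₁ A₂ τ (N₁ + N₂) 0 := by
  refine (Runs.forLoop (n := N₁ + N₂)
    (T := 4 + (k * ((N₁ + N₂) * ((N₁ + N₂) * 220 + 187) + 44) + 6))
    (I := fun p τ => τ.reg 5 = p ∧ Explored A₁ A₂ τ p 0) ?_ ?_ ?_).mono ?_ fun _ h => h.2
  · exact ⟨by simp [State.setReg], h.setReg (by decide)⟩
  · rintro p τ ⟨h5, hτ⟩
    exact ⟨h5, hτ.loaded.reg3⟩
  · rintro p τ hp ⟨h5, hτ⟩
    refine Runs.branch trivial (fun hb => ?_) (fun hb => ?_)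
    · simp only [Test.Holds, NatExpr.eval, h5] at hb
      refine (Runs.forLoop (n := k) (I := fun a τ => τ.reg 6 = a ∧ τ.reg 5 = p ∧ p < τ.reg 4 ∧
        Explored A₁ A₂ τ p a) ?_ ?_ ?_).mono
          (T := k * ((N₁ + N₂) * ((N₁ + N₂) * 220 + 187) + 36 + 1 + 7) + (1 + 5))
          (Nat.add_le_add (Nat.mul_le_mul_left _ (by omega)) (by omega)) ?_
      · exact ⟨by simp [State.setReg], by simp [State.setReg, h5], by simp [State.setReg, hb],
          hτ.setReg (by decide)⟩
      · rintro a υ ⟨h6, -, -, hυ⟩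
        exact ⟨h6, hυ.loaded.reg0⟩
      · rintro a υ ha ⟨h6, h5, hp, hυ⟩
        refine (Runs.extendBasis (a := ⟨a, ha⟩) hυ h5 hp h6).mono le_rfl ?_
        rintro ρ ⟨g5, gp, g6, hρ⟩
        exact ⟨g6, by simp [State.setReg], by simp [State.setReg, g5],
          by simp [State.setReg, gp], hρ.setReg (by decide)⟩
      · rintro υ ⟨-, g5, -, hυ⟩
        exact ⟨g5, by simp [State.setReg], hυ.next.setReg (by decide)⟩
    · simp only [Test.Holds, NatExpr.eval, h5] at hb
      refine (Runs.skip ?_).mono (by omega) fun _ h => h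
      -- Here every `i < n` satisfies `i < p`, so the invariant for `p` already covers all rows.
      exact ⟨h5, by simp [State.setReg], Explored.setReg ⟨hτ.loaded, hτ.basis,
        fun i x hi hx => hτ.closed i x hi (by omega)⟩ (by decide)⟩
  · simp only [NatExpr.cost]
    refine Nat.add_le_add (Nat.mul_le_mul_left _ ?_) (by omega)
    omega

/-! ### Reading off the answer. -/

/-- Answer whether all rows are orthogonal to the final weights. -/
def finish : Program :=
  .seq (.setReg 0 (.lit 1)) <| forLoop 7 (.reg 4) <| .seq (rowDot 0 7 7 (.reg 9)) <|
    .branch (.realEq (.cell 8 (.lit 0)) (.lit 0)) .skip (.setReg 0 (.lit 0))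

/-- The alphabet size in register 0 is no longer needed, so that register holds the answer: it
starts at 1 and is only ever lowered. Since `n ≤ d`, all rows have been treated and orthogonality to
them decides equivalence. -/
theorem Runs.finish {σ : State} (h : Explored A₁ A₂ σ (N₁ + N₂) 0) :
    Runs finish σ ((N₁ + N₂) * ((N₁ + N₂) * 27 + 30) + 8) fun τ =>
      Answers τ (A₁.Equivalent A₂) := by
  set d := N₁ + N₂ with hd
  set n := σ.reg 4 with hn
  have hnd : n ≤ d := h.basis.le_dim
  rw [Automaton.equivalent_iff_of_isOrthogonalBelow A₁ A₂ h.basis h.closed hnd]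
  set f := Automaton.jointFinal A₁ A₂ with hf
  set b := row d (σ.arr 6) with hb
  have hdot : ∀ i, ∑ s ∈ Finset.range d, σ.arr 6 (i * d + s) * σ.arr 7 (0 + s) = b i ⬝ᵥ f := by
    intro i
    simp only [Finset.sum_range, Nat.zero_add, h.loaded.arr7]
    rfl
  refine ((Runs.setReg (Q := fun τ => τ = σ.setReg 0 1) rfl).seq
    (T' := n * ((d * 27 + 9 + 7) + 1 + 7) + (1 + 5)) fun τ hτ => ?_).mono ?_ fun _ h => h
  · refine (Runs.forLoop (n := n) (T := d * 27 + 9 + 7)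
      (I := fun i τ => τ.reg 7 = i ∧ τ.reg 3 = d ∧ τ.reg 4 = n ∧
      τ.arr 6 = σ.arr 6 ∧ τ.arr 7 = σ.arr 7 ∧ Answers τ (∀ j < i, b j ⬝ᵥ f = 0))
      ?_ ?_ ?_).mono le_rfl fun _ h => h.2.2.2.2.2
    · subst hτ
      simp [State.setReg, Answers, h.loaded.reg3, ← hn, ← hd]
    · rintro i υ ⟨h7, h3, h4, -⟩
      exact ⟨h7, h4⟩
    · rintro i υ hi ⟨h7, h3, h4, h6, h7', hans⟩
      have h₁ := Runs.rowDot (c := 0) (x := 7) (m := 7) (e := .reg 9) (σ := υ) (base := 0)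
        (by decide) (by decide) (fun i => by simp [NatExpr.eval, State.setReg]) (by decide)
      rw [h3, h7, h6, h7', hdot] at h₁
      refine h₁.seq (T' := 7) fun ρ hρ => ?_
      have e8 : ρ.arr 8 0 = b i ⬝ᵥ f := by simp [hρ, State.setReg, State.setCell]
      have hall : (∀ j < i + 1, b j ⬝ᵥ f = 0) ↔ (∀ j < i, b j ⬝ᵥ f = 0) ∧ b i ⬝ᵥ f = 0 :=
        Nat.forall_lt_succ_right
      refine (Runs.branch (T := 2) (by exact ⟨trivial, trivial⟩)
        (fun ht => ?_) (fun ht => ?_)).mono (by decide)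
        fun _ h => h
      · have hz : b i ⬝ᵥ f = 0 := by
          simpa [Test.Holds, RealExpr.eval, NatExpr.eval, e8] using ht
        refine (Runs.skip ?_).mono (by decide) fun _ h => h
        refine ⟨by simp [hρ, State.setReg, State.setCell, h7], ?_⟩
        rw [hall]
        simpa [hρ, State.setReg, State.setCell, Answers, hz, h3, h4, h6, h7'] using hans
      · have hz : b i ⬝ᵥ f ≠ 0 := by
          simpa [Test.Holds, RealExpr.eval, NatExpr.eval, e8] using ht
        refine Runs.setReg ?_
        refine ⟨by simp [hρ, State.setReg, State.setCell, h7], ?_⟩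
        rw [hall]
        simp [hρ, State.setReg, State.setCell, Answers, hz, h3, h4, h6, h7', NatExpr.eval]
  · simp only [NatExpr.cost]
    have : n * ((d * 27 + 9 + 7) + 1 + 7) ≤ d * (d * 27 + 30) := Nat.mul_le_mul hnd (by omega)
    omega

/-! ### Initialization. -/

/-- Copy as many entries of array `l` as register `r` says to array `m` from address `o` on, times
a constant. -/
def copyScaled (q : ℚ) (l m r : ℕ) (o : NatExpr) : Program :=
  forLoop 8 (.reg r) (.setCell m (.add o (.reg 8)) (.mul (.lit q) (.cell l (.reg 8))))

theorem Runs.copyScaled {q : ℚ} {l m r : ℕ} {o : NatExpr} {σ : State} {O R : ℕ} (hlm : l ≠ m)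
    (hr8 : r ≠ 8) (hr9 : r ≠ 9) (hR : σ.reg r = R)
    (ho : ∀ τ : State, (∀ y, y ≠ 8 → y ≠ 9 → τ.reg y = σ.reg y) → o.eval τ = O)
    (hcost : o.cost ≤ 1) :
    Runs (copyScaled q l m r o) σ (R * 20 + 6) fun τ =>
      (∀ y, y ≠ 8 → y ≠ 9 → τ.reg y = σ.reg y) ∧ (∀ l ≠ m, τ.arr l = σ.arr l) ∧
      (∀ i < R, τ.arr m (O + i) = q * σ.arr l i) ∧
      (∀ j, (j < O ∨ O + R ≤ j) → τ.arr m j = σ.arr m j) := by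
  refine (Runs.fill (n := R) (T := 9 + o.cost) (base := O) (fun τ h => ?_) ?_).mono
    ?_ fun _ h => h
  · simp [NatExpr.eval, h r hr8 hr9, hR]
  · intro τ t ht h8 hreg harr hsame
    refine (Runs.setCell (by exact ⟨trivial, trivial⟩) ?_).mono
      (by simp only [NatExpr.cost, RealExpr.cost]; omega) fun _ h => h
    refine ⟨fun y _ => rfl, ?_⟩
    simp [State.setCell, RealExpr.eval, NatExpr.eval, ho τ hreg, h8, harr l hlm]
  · simp only [NatExpr.cost]
    refine Nat.add_le_add (Nat.mul_le_mul_left _ (by omega)) (by omega)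

/-- Store the two initial vectors as the first row, and the final weights of the difference. -/
def setup : Program :=
  .seq (.setReg 3 (.add (.reg 1) (.reg 2))) <| .seq (.setReg 4 (.lit 1)) <|
    .seq (copyScaled 1 0 6 1 (.lit 0)) <| .seq (copyScaled 1 3 6 2 (.reg 1)) <|
      .seq (copyScaled 1 1 7 1 (.lit 0)) (copyScaled (-1) 4 7 2 (.reg 1))

theorem vecArray_val {n : ℕ} (f : Fin n → ℝ) (i : Fin n) : vecArray f i = f i := by
  simp [vecArray]

theorem Runs.setup (hA : A₁.IsProbabilistic) :
    Runs setup (input A₁ A₂) ((N₁ + N₂) * 40 + 30) fun τ => Explored A₁ A₂ τ 0 0 := by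
  set σ := ((input A₁ A₂).setReg 3 (N₁ + N₂)).setReg 4 1 with hσ
  have e1 : σ.reg 1 = N₁ := rfl
  have e2 : σ.reg 2 = N₂ := rfl
  refine ((Runs.setReg (Q := fun τ => τ = (input A₁ A₂).setReg 3 (N₁ + N₂)) rfl).seq
    (T' := 2 + (N₁ * 20 + 6 + (N₂ * 20 + 6 + (N₁ * 20 + 6 + (N₂ * 20 + 6))))) ?_).mono
    (by simp only [NatExpr.cost]; omega) fun _ h => h
  rintro _ rfl
  refine (Runs.setReg (Q := fun τ => τ = σ) rfl).seq ?_
  rintro _ rfl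
  refine (Runs.copyScaled (O := 0) (by decide) (by decide) (by decide) e1 (fun _ _ => rfl)
    le_rfl).seq ?_
  rintro τ₁ ⟨r₁, l₁, new₁, old₁⟩
  refine (Runs.copyScaled (O := N₁) (by decide) (by decide) (by decide)
    ((r₁ 2 (by decide) (by decide)).trans e2)
    (fun τ h => by exact (h 1 (by decide) (by decide)).trans (r₁ 1 (by decide) (by decide)))
    le_rfl).seq ?_
  rintro τ₂ ⟨r₂, l₂, new₂, old₂⟩
  have r₂' : ∀ y, y ≠ 8 → y ≠ 9 → τ₂.reg y = σ.reg y :=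
    fun y h8 h9 => (r₂ y h8 h9).trans (r₁ y h8 h9)
  refine (Runs.copyScaled (O := 0) (by decide) (by decide) (by decide)
    ((r₂' 1 (by decide) (by decide)).trans e1) (fun _ _ => rfl) le_rfl).seq ?_
  rintro τ₃ ⟨r₃, l₃, new₃, old₃⟩
  have r₃' : ∀ y, y ≠ 8 → y ≠ 9 → τ₃.reg y = σ.reg y :=
    fun y h8 h9 => (r₃ y h8 h9).trans (r₂' y h8 h9)
  refine (Runs.copyScaled (O := N₁) (by decide) (by decide) (by decide)
    ((r₃' 2 (by decide) (by decide)).trans e2)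
    (fun τ h => by exact (h 1 (by decide) (by decide)).trans (r₃' 1 (by decide) (by decide)))
    le_rfl).mono
    le_rfl ?_
  rintro τ₄ ⟨r₄, l₄, new₄, old₄⟩
  have r₄' : ∀ y, y ≠ 8 → y ≠ 9 → τ₄.reg y = σ.reg y :=
    fun y h8 h9 => (r₄ y h8 h9).trans (r₃' y h8 h9)
  have l₃' : ∀ l, l ≠ 6 → l ≠ 7 → τ₃.arr l = σ.arr l :=
    fun l h6 h7 => by rw [l₃ l h7, l₂ l h6, l₁ l h6]
  -- The last two copies write only array 7, and the second copy starts at `N₁`, behind the first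
  -- block.
  have hrow : row (N₁ + N₂) (τ₄.arr 6) 0 = Automaton.jointVec A₁ A₂ [] := by
    rw [Automaton.jointVec_nil, l₄ 6 (by decide), l₃ 6 (by decide)]
    ext s
    simp only [row, Nat.zero_mul]
    refine Fin.addCases (fun s => ?_) (fun s => ?_) s
    · rw [Fin.val_castAdd, old₂ _ (by omega), new₁ s s.2, Fin.append_left]
      simp [hσ, State.setReg, input, vecArray_val]
    · rw [Fin.val_natAdd, Nat.zero_add, new₂ s s.2, l₁ 3 (by decide), Fin.append_right]
      simp [hσ, State.setReg, input, vecArray_val]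
  have h4 : τ₄.reg 4 = 1 := r₄' 4 (by decide) (by decide)
  refine ⟨⟨r₄' 0 (by decide) (by decide), r₄' 1 (by decide) (by decide),
    r₄' 2 (by decide) (by decide), r₄' 3 (by decide) (by decide), ?_, ?_, ?_⟩, ?_, ?_⟩
  · rw [l₄ 2 (by decide), l₃' 2 (by decide) (by decide)]; rfl
  · rw [l₄ 5 (by decide), l₃' 5 (by decide) (by decide)]; rfl
  · intro s
    refine Fin.addCases (fun s => ?_) (fun s => ?_) s
    · have := new₃ s s.2
      rw [Nat.zero_add] at this
      rw [Fin.val_castAdd, old₄ _ (by omega), this, l₂ 1 (by decide), l₁ 1 (by decide)]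
      simp [hσ, State.setReg, input, vecArray_val, Automaton.jointFinal]
    · rw [Fin.val_natAdd, new₄ s s.2, l₃' 4 (by decide) (by decide)]
      simp [hσ, State.setReg, input, vecArray_val, Automaton.jointFinal]
  · rw [h4]
    exact .of_init (Automaton.jointVec_nil_ne_zero A₁ A₂ hA) (Submodule.subset_span ⟨[], rfl⟩) hrow
  · intro i x _ hx
    omega

/-! ### The whole program and its total cost. -/

/-- The program that decides equivalence. -/
def decideEquivalence : Program := .seq setup (.seq explore finish)

theorem Runs.decideEquivalence (hA : A₁.IsProbabilistic) :
    Runs decideEquivalence (input A₁ A₂) (10000 * ((k + 1) * max N₁ N₂ ^ 4)) fun τ =>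
      Answers τ (A₁.Equivalent A₂) := by
  refine ((Runs.setup hA).seq fun τ h => (Runs.explore h).seq fun υ h => Runs.finish h).mono ?_
    fun _ h => h
  have hpos := Automaton.pos_of_isProbabilistic hA
  set N := max N₁ N₂ with hN
  have hN1 : 1 ≤ N := hpos.trans_le (le_max_left _ _)
  have hd : N₁ + N₂ ≤ 2 * N := by
    have := le_max_left N₁ N₂
    have := le_max_right N₁ N₂
    omega
  generalize N₁ + N₂ = d at hd ⊢
  -- Since `1 ≤ N`, lower powers and constants are absorbed into `N ^ 4`, each power being an atom
  -- for `omega`. The coefficients add up to 2596 in the factor of `k` and to 328 in the rest, so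
  -- 10000 is generous.
  have p2 : N ≤ N ^ 2 := Nat.le_self_pow (by decide) N
  have p3 : N ^ 2 ≤ N ^ 3 := Nat.pow_le_pow_right hN1 (by decide)
  have p4 : N ^ 3 ≤ N ^ 4 := Nat.pow_le_pow_right hN1 (by decide)
  calc _ ≤ 2 * N * 40 + 30 + (2 * N * (k * (2 * N * (2 * N * 220 + 187) + 44) + 18) + 6 +
        (2 * N * (2 * N * 27 + 30) + 8)) := by gcongr
    _ = k * (1760 * N ^ 3 + 748 * N ^ 2 + 88 * N) + (108 * N ^ 2 + 176 * N + 44) := by ring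
    _ ≤ k * (10000 * N ^ 4) + 10000 * N ^ 4 := by
      refine Nat.add_le_add (Nat.mul_le_mul_left _ ?_) ?_ <;> omega
    _ = 10000 * ((k + 1) * N ^ 4) := by ring

end Verification

end RealRAM

theorem corollaryc :
    ∃ (P : RealRAM.Program) (C : ℕ), ∀ (k N₁ N₂ : ℕ)
      (A₁ : Automaton k N₁) (A₂ : Automaton k N₂),
      A₁.IsProbabilistic → A₂.IsProbabilistic →
      ∃ (τ : RealRAM.State) (t : ℕ),
        RealRAM.Exec P (RealRAM.input A₁ A₂) τ t ∧
        RealRAM.Answers τ (A₁.Equivalent A₂) ∧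
        t ≤ C * ((k + 1) * max N₁ N₂ ^ 4) := by
  refine ⟨RealRAM.decideEquivalence, 10000, fun k N₁ N₂ A₁ A₂ h₁ _ => ?_⟩
  obtain ⟨τ, t, h, ht, hτ⟩ := RealRAM.Runs.decideEquivalence (A₁ := A₁) (A₂ := A₂) h₁
  exact ⟨τ, t, h, hτ, ht⟩
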